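/- Let $R_\infty$ be the infinite symmetric inverse semigroup, that is, the monoid (under matrix multiplication) of all infinite $0$-$1$ matrices $r=[r_{ij}]_{i,j\in\mathbb N}$ with at most one entry $1$ in each row and each column and with $r_{nn}=1$ for all but finitely many $n$. It has the involution $[r_{ij}]^*=[r_{ji}]$ and the unit $e$, and it contains the group $\mathfrak S_\infty$ of finitary permutations of $\mathbb N$ as permutation matrices. For a finite set $\mathbb A\subset\mathbb N$ let $\epsilon_{\mathbb A}\in R_\infty$ be the diagonal matrix with diagonal entry $0$ at the places in $\mathbb A$ and $1$ elsewhere. For a cycle $c=(n_1\,n_2\,\dots\,n_k)\in\mathfrak S_\infty$ with distinct $n_1,\dots,n_k$, $k\ge 1$, put $\operatorname{supp}c=\{n_1,\dots,n_k\}$ (for $k=1$ the cycle $(n_1)$ is the unit $e$, with the support $\{n_1\}$). A quasicycle is an element $c\cdot\epsilon_{\mathbb A}$ with $c$ such a cycle and $\mathbb A\subseteq\operatorname{supp}c$. An indecomposable character of $R_\infty$ is a function $f:R_\infty\to\mathbb C$ that is 1. central: $f(rs)=f(sr)$ for all $r,s\in R_\infty$; 2. positive definite: for all $r_1,\dots,r_n\in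 R_\infty$ the matrix $[f(r_i^*r_j)]$ is Hermitian and non-negative definite; 3. indecomposable: $f$ is not a sum of two linearly independent functions satisfying (1) and (2); 4. normalized: $f(e)=1$. Let $f$ be an indecomposable character of $R_\infty$. Then there exists $\rho\in[0,1]$ such that, for every quasicycle $q=c\cdot\epsilon_{\mathbb A}$ with $\mathbb A\neq\emptyset$, $$f(q)=\rho^{\#(\operatorname{supp}c)}.$$ -/

import Mathlib

open scoped ComplexOrder

/-- The infinite symmetric inverse semigroup `R_∞`: infinite 0-1 matrices, indexed by `ℕ`, with at
most one `1` in each row and each column and with all but finitely many diagonal entries equal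
to `1`. Such a matrix `r` is encoded by the partial injection `r.1` of `ℕ` with
`r.1 j = some i` if and only if `r_{ij} = 1` (see `RInf.entry`). -/
def RInf : Type := {r : ℕ ≃. ℕ // {n | r n ≠ some n}.Finite}

namespace RInf

/-- The matrix entry `r_{ij}`. -/
def entry (r : RInf) (i j : ℕ) : ℕ := if r.1 j = some i then 1 else 0

/-- The support of `r`: the complement of `{n | r_{nn} = 1}`. -/
def supp (r : RInf) : Set ℕ := {n | r.entry n n = 1}ᶜ

@[ext]
theorem ext' {r s : RInf} (h : ∀ n, r.1 n = s.1 n) : r = s :=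
  Subtype.ext (PEquiv.ext h)

/-- Multiplication is multiplication of matrices (see `RInf.entry_mul`), that is, composition of
partial injections, the right factor being applied first; the unit is the identity matrix. -/
instance instMonoid : Monoid RInf where
  mul r s := ⟨s.1.trans r.1, by
    refine (r.2.union s.2).subset fun n hn => ?_
    by_contra h
    simp only [Set.mem_union, Set.mem_ofPred_eq, not_or, not_not] at h
    apply hn
    change (s.1 n).bind r.1 = some n
    rw [h.2]
    exact h.1⟩
  one := ⟨PEquiv.refl ℕ, by simp⟩
  mul_assoc r s t := Subtype.ext (PEquiv.trans_assoc t.1 s.1 r.1).symm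
  one_mul r := Subtype.ext (PEquiv.trans_refl r.1)
  mul_one r := Subtype.ext (PEquiv.refl_trans r.1)

/-- The involution of `R_∞` is the transposition of matrices (see `RInf.entry_star`), that is, the
inversion of partial injections. -/
instance instStarMul : StarMul RInf where
  star r := ⟨r.1.symm, by
    refine r.2.subset fun n hn h => hn ?_
    exact (PEquiv.eq_some_iff r.1).2 h⟩
  star_involutive r := Subtype.ext (PEquiv.symm_symm r.1)
  star_mul r s := Subtype.ext (PEquiv.symm_trans_rev s.1 r.1)

theorem entry_one (i j : ℕ) : entry 1 i j = if i = j then 1 else 0 := by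
  change (if some j = some i then 1 else 0) = _
  simp [eq_comm]

theorem entry_star (r : RInf) (i j : ℕ) : entry (star r) i j = entry r j i := by
  unfold entry
  congr 1
  exact propext (PEquiv.eq_some_iff r.1)

theorem entry_mul (r s : RInf) (i j : ℕ) :
    entry (r * s) i j = ∑ᶠ k, entry r i k * entry s k j := by
  have hrs : (r * s).1 j = (s.1 j).bind r.1 := rfl
  unfold entry
  rw [hrs]
  rcases h : s.1 j with _ | m
  · simp
  · rw [finsum_eq_single _ m]
    · simp
    · intro k hk
      simp [Ne.symm hk]

/-- The diagonal matrix `ε_A`, with diagonal entry `0` at the places in `A` and `1` elsewhere. -/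
def eps (A : Finset ℕ) : RInf :=
  ⟨PEquiv.ofSet {n | n ∉ A}, by
    refine A.finite_toSet.subset fun n hn => ?_
    by_contra h
    exact hn (by simpa [PEquiv.ofSet] using h)⟩

/-- The cycle `(n₁ n₂ … n_k)`, as an element of the infinite symmetric group inside `R_∞`, for the
list `l = [n₁, n₂, …, n_k]` of distinct numbers: it carries `n₁` to `n₂`, …, `n_k` to `n₁` and
fixes the other numbers. For `k = 1` it is the unit. -/
def cycle (l : List ℕ) : RInf :=
  ⟨l.formPerm.toPEquiv, by
    refine l.toFinset.finite_toSet.subset fun n hn => ?_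
    by_contra h
    apply hn
    have h' : n ∉ l := by simpa using h
    simp [Equiv.toPEquiv_apply, List.formPerm_apply_of_notMem h']⟩

/-- The support `{n₁, …, n_k}` of the cycle `(n₁ n₂ … n_k)`. The cycle `(n₁)` of length one has
the support `{n₁}`, so that `ε_{n₁} = (n₁) · ε_{n₁}` is a quasicycle. For `k ≥ 2` this is
the support of the cycle as an element of `R_∞` (see `RInf.supp_cycle`). -/
def cycleSupp (l : List ℕ) : Finset ℕ := l.toFinset

theorem supp_cycle (l : List ℕ) (hl : l.Nodup) (h2 : 2 ≤ l.length) :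
    supp (cycle l) = cycleSupp l := by
  ext n
  have hne : ∀ x, l ≠ [x] := by
    rintro x rfl
    simp at h2
  have key := List.support_formPerm_of_nodup' l hl hne
  have hmem : (l.formPerm n ≠ n) ↔ n ∈ l := by
    have := Set.ext_iff.1 key n
    simpa using this
  simp [supp, entry, cycle, cycleSupp, Equiv.toPEquiv_apply, ← hmem]

/-- `f(rs) = f(sr)` for all `r`, `s`. -/
def IsCentral (f : RInf → ℂ) : Prop := ∀ r s : RInf, f (r * s) = f (s * r)

/-- For all `r₁, …, r_n` the matrix `[f(r_i^* r_j)]` is Hermitian and non-negative definite. -/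
def IsPosDef (f : RInf → ℂ) : Prop :=
  ∀ (n : ℕ) (r : Fin n → RInf),
    (Matrix.of fun i j => f (star (r i) * r j) : Matrix (Fin n) (Fin n) ℂ).PosSemidef

/-- `f` is not a sum of two linearly independent central positive definite functions. -/
def IsIndecomposable (f : RInf → ℂ) : Prop :=
  ¬ ∃ g h : RInf → ℂ, IsCentral g ∧ IsPosDef g ∧ IsCentral h ∧ IsPosDef h ∧
    LinearIndependent ℂ ![g, h] ∧ f = g + h

/-- Indecomposable (finite) characters of `R_∞`. -/
structure IsIndecomposableCharacter (f : RInf → ℂ) : Prop where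
  central : IsCentral f
  posDef : IsPosDef f
  indecomposable : IsIndecomposable f
  map_one : f 1 = 1

end RInf

namespace RInf

open Matrix

/-! Centrality makes `f (r * eps {n})` independent of the point `n` fixed by `r`; call it `compress
f r`. Since `eps {n}` is a self-adjoint idempotent commuting with such `r`, both `compress f` and `f
- compress f` are central and positive definite. Indecomposability then forces `compress f = ρ • f`
with `ρ = compress f 1`, whence `f (eps A) = ρ ^ A.card`. For a quasicycle, centrality lets the
nonempty set `A` spread along the cycle until it fills the support, where the cycle is absorbed
(`cycle_mul_eps_cycleSupp`). -/

theorem mul_apply (r s : RInf) (n : ℕ) : (r * s).1 n = (s.1 n).bind r.1 := rfl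

theorem one_apply (n : ℕ) : (1 : RInf).1 n = some n := rfl

theorem eps_apply (A : Finset ℕ) (n : ℕ) : (eps A).1 n = if n ∈ A then none else some n := by
  by_cases h : n ∈ A <;> simp [eps, PEquiv.ofSet, h]

theorem cycle_apply (l : List ℕ) (n : ℕ) : (cycle l).1 n = some (l.formPerm n) := rfl

theorem star_apply_eq_some {r : RInf} {n : ℕ} (h : r.1 n = some n) : (star r).1 n = some n :=
  (PEquiv.eq_some_iff r.1).2 h

theorem mul_apply_eq_some {r s : RInf} {n : ℕ} (hr : r.1 n = some n) (hs : s.1 n = some n) :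
    (r * s).1 n = some n := by
  rw [mul_apply, hs]
  exact hr

theorem exists_forall_apply_eq_some {ι : Type*} [Finite ι] (r : ι → RInf) :
    ∃ n, ∀ i, (r i).1 n = some n := by
  obtain ⟨n, hn⟩ := (Set.finite_iUnion fun i => (r i).2).exists_notMem
  exact ⟨n, fun i => by_contra fun h => hn (Set.mem_iUnion.2 ⟨i, h⟩)⟩

theorem eps_empty : eps ∅ = 1 := by
  ext1 n
  simp [eps_apply, one_apply]

theorem eps_mul_eps (A B : Finset ℕ) : eps A * eps B = eps (A ∪ B) := by
  ext1 n
  by_cases hB : n ∈ B <;> simp [mul_apply, eps_apply, hB]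

theorem star_eps (A : Finset ℕ) : star (eps A) = eps A :=
  Subtype.ext (PEquiv.ofSet_symm {n | n ∉ A})

theorem eps_singleton_comm {r : RInf} {n : ℕ} (h : r.1 n = some n) :
    eps {n} * r = r * eps {n} := by
  ext1 m
  rw [mul_apply, mul_apply, eps_apply]
  by_cases hm : m = n
  · subst hm
    simp [h, eps_apply]
  · rcases hr : r.1 m with _ | k
    · simp [hm, hr]
    · have hk : k ≠ n := by
        rintro rfl
        exact hm (r.1.inj hr h)
      simp [hm, hr, hk, eps_apply]

theorem eps_mul_cycle (l : List ℕ) (A : Finset ℕ) :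
    eps A * cycle l = cycle l * eps (A.image l.formPerm.symm) := by
  ext1 m
  have : (∃ a ∈ A, l.formPerm.symm a = m) ↔ l.formPerm m ∈ A := by
    constructor
    · rintro ⟨a, ha, rfl⟩
      simpa using ha
    · exact fun h => ⟨_, h, by simp⟩
  by_cases h : l.formPerm m ∈ A <;>
    simp [mul_apply, cycle_apply, eps_apply, this, h]

theorem cycle_mul_eps_cycleSupp (l : List ℕ) : cycle l * eps (cycleSupp l) = eps (cycleSupp l) := by
  ext1 m
  by_cases h : m ∈ l <;>
    simp [mul_apply, eps_apply, cycleSupp, h, cycle_apply, List.formPerm_apply_of_notMem]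

theorem cycle_pair_mul_self (n m : ℕ) : cycle [n, m] * cycle [n, m] = 1 := by
  ext1 k
  simp [mul_apply, cycle_apply, one_apply]

theorem cycle_pair_comm {r : RInf} {n m : ℕ} (hn : r.1 n = some n) (hm : r.1 m = some m) :
    cycle [n, m] * r = r * cycle [n, m] := by
  ext1 k
  rw [mul_apply, mul_apply, cycle_apply, Option.bind_some, List.formPerm_pair]
  by_cases hkn : k = n
  · subst hkn
    simp [hn, hm, cycle_apply]
  by_cases hkm : k = m
  · subst hkm
    simp [hn, hm, cycle_apply]
  rw [Equiv.swap_apply_of_ne_of_ne hkn hkm]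
  rcases hr : r.1 k with _ | j
  · rfl
  · have hjn : j ≠ n := by
      rintro rfl
      exact hkn (r.1.inj hr hn)
    have hjm : j ≠ m := by
      rintro rfl
      exact hkm (r.1.inj hr hm)
    simp [cycle_apply, Equiv.swap_apply_of_ne_of_ne hjn hjm]

/-- Conjugation by the transposition of `n` and `m` fixes `r` and exchanges the two idempotents. -/
theorem IsCentral.mul_eps_singleton_eq {f : RInf → ℂ} (hf : IsCentral f) {r : RInf} {n m : ℕ}
    (hn : r.1 n = some n) (hm : r.1 m = some m) : f (r * eps {n}) = f (r * eps {m}) := by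
  have h : cycle [n, m] * (r * eps {n} * cycle [n, m]) = r * eps {m} := by
    rw [mul_assoc r, eps_mul_cycle, ← mul_assoc, cycle_pair_comm hn hm, mul_assoc,
      ← mul_assoc (cycle _) (cycle _), cycle_pair_mul_self, one_mul]
    simp
  rw [← h, hf (cycle _), mul_assoc (r * eps {n}), cycle_pair_mul_self, mul_one]

/-- The function `r ↦ f (r ε_n)`, where `n` is any point fixed by `r`. -/
noncomputable def compress (f : RInf → ℂ) (r : RInf) : ℂ :=
  f (r * eps {(exists_forall_apply_eq_some fun _ : Unit => r).choose})

theorem IsCentral.compress_eq {f : RInf → ℂ} (hf : IsCentral f) {r : RInf} {n : ℕ}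
    (hn : r.1 n = some n) : compress f r = f (r * eps {n}) :=
  hf.mul_eps_singleton_eq ((exists_forall_apply_eq_some fun _ : Unit => r).choose_spec ()) hn

theorem IsCentral.compress {f : RInf → ℂ} (hf : IsCentral f) : IsCentral (compress f) := by
  intro r s
  obtain ⟨n, hn⟩ := exists_forall_apply_eq_some ![r, s]
  have hr : r.1 n = some n := hn 0
  have hs : s.1 n = some n := hn 1
  rw [hf.compress_eq (mul_apply_eq_some hr hs), hf.compress_eq (mul_apply_eq_some hs hr),
    mul_assoc, hf, mul_assoc, eps_singleton_comm hr, mul_assoc]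

theorem star_mul_eps_mul_mul_eps {r s : RInf} {n : ℕ} (hr : r.1 n = some n)
    (hs : s.1 n = some n) : star (r * eps {n}) * (s * eps {n}) = star r * s * eps {n} := by
  have h := eps_singleton_comm (mul_apply_eq_some (star_apply_eq_some hr) hs)
  calc star (r * eps {n}) * (s * eps {n}) = eps {n} * (star r * s) * eps {n} := by
        rw [star_mul, star_eps]
        simp only [mul_assoc]
    _ = star r * s * eps {n} := by
        rw [h, mul_assoc, eps_mul_eps, Finset.union_self]

theorem compress_posDef {f : RInf → ℂ} (hc : IsCentral f) (hf : IsPosDef f) :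
    IsPosDef (compress f) := by
  intro m r
  obtain ⟨n, hn⟩ := exists_forall_apply_eq_some r
  convert hf m fun i => r i * eps {n} using 5 with i j
  rw [star_mul_eps_mul_mul_eps (hn i) (hn j),
    hc.compress_eq (mul_apply_eq_some (star_apply_eq_some (hn i)) (hn j))]

/-- The Gram matrix of the family `r i` together with `r i * eps {n}` has blocks `F, G, G, G`;
restricting its form to the vectors `(v, -v)` leaves `F - G`. -/
theorem sub_compress_posDef {f : RInf → ℂ} (hc : IsCentral f) (hf : IsPosDef f) :
    IsPosDef (f - compress f) := by
  intro m r
  obtain ⟨n, hn⟩ := exists_forall_apply_eq_some r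
  set F : Matrix (Fin m) (Fin m) ℂ := of fun i j => f (star (r i) * r j) with hF
  set G : Matrix (Fin m) (Fin m) ℂ := of fun i j => f (star (r i) * r j * eps {n}) with hG
  have hFG : (of fun i j => (f - compress f) (star (r i) * r j)) = F - G := by
    ext i j
    simp [hF, hG, hc.compress_eq (mul_apply_eq_some (star_apply_eq_some (hn i)) (hn j))]
  have hblock : (fromBlocks F G G G).PosSemidef := by
    convert (hf (m + m) (Sum.elim r (fun i => r i * eps {n}) ∘ finSumFinEquiv.symm)).submatrix
      finSumFinEquiv using 1
    ext (i | i) (j | j)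
    · simp [hF]
    · simp [hG, mul_assoc, -finSumFinEquiv_apply_right]
    · simp only [fromBlocks_apply₂₁, hG, of_apply, submatrix_apply, Function.comp_apply,
        Equiv.symm_apply_apply, Sum.elim_inl, Sum.elim_inr]
      rw [star_mul, star_eps, mul_assoc, ← mul_assoc, hc, mul_assoc (eps {n})]
    · simp [hG, ← star_mul_eps_mul_mul_eps (hn i) (hn j), -finSumFinEquiv_apply_right]
  have := hblock.conjTranspose_mul_mul_same (fromRows 1 (-1) : Matrix (Fin m ⊕ Fin m) (Fin m) ℂ)
  rw [hFG]
  convert this using 1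
  rw [Matrix.mul_assoc, fromBlocks_mul_fromRows, conjTranspose_fromRows_eq_fromCols_conjTranspose,
    fromCols_mul_fromRows]
  simp [sub_eq_add_neg]

theorem IsPosDef.map_one_nonneg {f : RInf → ℂ} (hf : IsPosDef f) : 0 ≤ f 1 := by
  simpa using (hf 1 fun _ => 1).diag_nonneg (i := 0)

theorem IsIndecomposableCharacter.compress_eq_mul {f : RInf → ℂ}
    (hf : IsIndecomposableCharacter f) (r : RInf) : compress f r = compress f 1 * f r := by
  by_contra hr
  refine hf.indecomposable ⟨compress f, f - compress f, hf.central.compress,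
    compress_posDef hf.central hf.posDef,
    fun r s => by simp only [Pi.sub_apply, hf.central r s, hf.central.compress r s],
    sub_compress_posDef hf.central hf.posDef, ?_, by simp⟩
  rw [LinearIndependent.pair_iff]
  intro a b hab
  have h1 := congrFun hab 1
  have h2 := congrFun hab r
  simp only [Pi.add_apply, Pi.smul_apply, Pi.sub_apply, Pi.zero_apply, smul_eq_mul,
    hf.map_one] at h1 h2
  -- The relation at `r` minus `f r` times the relation at `1`.
  have h3 : (a - b) * (compress f r - compress f 1 * f r) = 0 := by
    linear_combination h2 - f r * h1
  have h4 : a = b := sub_eq_zero.1 ((mul_eq_zero.1 h3).resolve_right (sub_ne_zero.2 hr))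
  have h5 : b = 0 := by
    rw [h4] at h1
    linear_combination h1
  exact ⟨h4.trans h5, h5⟩

theorem IsIndecomposableCharacter.map_eps {f : RInf → ℂ} (hf : IsIndecomposableCharacter f)
    (A : Finset ℕ) : f (eps A) = compress f 1 ^ A.card := by
  induction A using Finset.induction_on with
  | empty => simp [eps_empty, hf.map_one]
  | insert a A ha ih =>
    have hfix : (eps A).1 a = some a := by simp [eps_apply, ha]
    rw [Finset.card_insert_of_notMem ha, pow_succ', ← ih, ← hf.compress_eq_mul,
      hf.central.compress_eq hfix, eps_mul_eps, Finset.union_comm, Finset.insert_eq]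

/-- Split off one copy of the idempotent `eps A`, move it to the front by centrality, and carry it
back through the cycle, which turns `A` into its preimage. -/
theorem IsCentral.map_cycle_mul_eps {f : RInf → ℂ} (hf : IsCentral f) (l : List ℕ) (A : Finset ℕ) :
    f (cycle l * eps A) = f (cycle l * eps (A.image l.formPerm.symm ∪ A)) := by
  conv_lhs => rw [← Finset.union_self A, ← eps_mul_eps, ← mul_assoc, hf, ← mul_assoc,
    eps_mul_cycle, mul_assoc, eps_mul_eps]

theorem IsCentral.map_cycle_mul_eps_eq {f : RInf → ℂ} (hf : IsCentral f) {l : List ℕ}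
    (hl : l.Nodup) {A : Finset ℕ} (hA : A ⊆ cycleSupp l) (hne : A.Nonempty) :
    f (cycle l * eps A) = f (eps (cycleSupp l)) := by
  -- A maximal `B` with the same value of `f` is closed under preimages by the cycle; as the cycle
  -- is transitive on its support, `B` is all of it.
  obtain ⟨B, hB⟩ := ((cycleSupp l).powerset.filter fun B =>
      A ⊆ B ∧ f (cycle l * eps A) = f (cycle l * eps B)).exists_maximal
    ⟨A, by simp [hA]⟩
  have hBmem := hB.prop
  simp only [Finset.mem_filter, Finset.mem_powerset] at hBmem
  obtain ⟨hBl, hAB, hfB⟩ := hBmem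
  have hmem : ∀ x, l.formPerm x ∈ B → x ∈ B := by
    intro x hx
    have hsub : B.image l.formPerm.symm ∪ B ⊆ cycleSupp l := by
      refine Finset.union_subset (fun y hy => ?_) hBl
      obtain ⟨z, hz, rfl⟩ := Finset.mem_image.1 hy
      have hz' : z ∈ l := by simpa [cycleSupp] using hBl hz
      have : l.formPerm (l.formPerm.symm z) ∈ l := by simpa using hz'
      simpa [cycleSupp] using List.mem_of_formPerm_apply_mem this
    refine hB.le_of_ge (y := B.image l.formPerm.symm ∪ B) ?_ Finset.subset_union_right
      (Finset.mem_union_left _ (Finset.mem_image.2 ⟨_, hx, by simp⟩))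
    simp only [Finset.mem_filter, Finset.mem_powerset]
    exact ⟨hsub, hAB.trans Finset.subset_union_right, hfB.trans (hf.map_cycle_mul_eps l B)⟩
  have hpow : ∀ (k : ℕ) x, (l.formPerm ^ k) x ∈ B → x ∈ B := by
    intro k
    induction k with
    | zero => exact fun x hx => hx
    | succ k ih =>
      intro x hx
      rw [pow_succ, Equiv.Perm.mul_apply] at hx
      exact hmem x (ih _ hx)
  have hBeq : B = cycleSupp l := by
    refine hBl.antisymm fun x hx => ?_
    obtain ⟨b, hb⟩ := hne
    have hcyc : l.formPerm.IsCycleOn (cycleSupp l : Set ℕ) := by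
      simpa [cycleSupp] using hl.isCycleOn_formPerm
    obtain ⟨k, -, hk⟩ := hcyc.exists_pow_eq hx (hA hb)
    exact hpow k x (hk ▸ hAB hb)
  rw [hfB, hBeq, cycle_mul_eps_cycleSupp]

end RInf

theorem mainTheorem3 (f : RInf → ℂ) (hf : RInf.IsIndecomposableCharacter f) :
    ∃ ρ : ℝ, ρ ∈ Set.Icc (0 : ℝ) 1 ∧
      ∀ l : List ℕ, l.Nodup →
        ∀ A : Finset ℕ, A ⊆ RInf.cycleSupp l → A.Nonempty →
          f (RInf.cycle l * RInf.eps A) = (ρ : ℂ) ^ (RInf.cycleSupp l).card := by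
  have h0 := (RInf.compress_posDef hf.central hf.posDef).map_one_nonneg
  have h1 := (RInf.sub_compress_posDef hf.central hf.posDef).map_one_nonneg
  rw [Pi.sub_apply, hf.map_one, sub_nonneg] at h1
  have hρ : ((RInf.compress f 1).re : ℂ) = RInf.compress f 1 :=
    Complex.ext rfl (Complex.le_def.1 h0).2
  refine ⟨(RInf.compress f 1).re,
    ⟨(Complex.le_def.1 h0).1, (Complex.le_def.1 h1).1⟩, fun l hl A hA hne => ?_⟩
  rw [hf.central.map_cycle_mul_eps_eq hl hA hne, hf.map_eps, hρ]
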